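/- Theorem (Inductive Property). Let $D\ge 0$ and $K\ge 1$ be integers, and let $$p(x)=\sum_{k=1}^K \pi_k\,(2\pi)^{-D/2}\,|\Sigma_k|^{-1/2}\,e^{-\frac12 (x-\mu_k)^T\Sigma_k^{-1}(x-\mu_k)},\qquad x\in\mathbb{R}^D,$$ be the density of a mixture of Gaussians, with weights $\pi_k>0$, $\sum_k\pi_k=1$, means $\mu_k\in\mathbb{R}^D$ and symmetric positive definite covariance matrices $\Sigma_k\in\mathbb{R}^{D\times D}$. Put $f=-\ln p$. An equilibrium vector is a point $x$ with $\nabla f(x)=0$; it is hyperbolic if the Hessian of $f$ at $x$ has no zero eigenvalue, and a stable equilibrium vector (SEV) if it is hyperbolic and all eigenvalues of this Hessian are positive. Assume that $f$ is a Morse function, i.e. that all its equilibrium vectors are hyperbolic. Let $R$ be a continuously differentiable Riemannian metric on $\mathbb{R}^D$, i.e. a $C^1$ map that assigns to each $x\in\mathbb{R}^D$ a symmetric positive definite matrix $R(x)\in\mathbb{R}^{D\times D}$, and assume that its condition number is bounded: $\sup_{x\in\mathbb{R}^D}\|R(x)\|\,\|R(x)^{-1}\|<\infty$ in the operator norm of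 the Euclidean norm. Consider the MoG gradient system $$\frac{dx}{dt}=R(x)^{-1}\,\nabla\ln p(x)=-R(x)^{-1}\nabla f(x).$$ A trajectory is a solution $x:[0,\infty)\to\mathbb{R}^D$ of it, and the basin cell of an SEV $x^0$ is the closed set $$\mathfrak{B}(x^0)=\mathrm{cl}\{x(0) : x(\cdot)\text{ is a trajectory with }\lim_{t\to\infty}x(t)=x^0\}.$$ Then there is exactly one trajectory from each initial point in $\mathbb{R}^D$; every trajectory is bounded on $[0,\infty)$ and converges, as $t\to\infty$, to an equilibrium vector. Moreover the system has only finitely many SEVs $x^0_1,\dots,x^0_s$, and $$\mathbb{R}^D=\mathfrak{B}(x^0_1)\cup\dots\cup\mathfrak{B}(x^0_s),$$ where $\mathfrak{B}(x^0_i)\cap\mathfrak{B}(x^0_j)$ has Lebesgue measure zero whenever $i\ne j$. -/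

import Mathlib

open Set Filter Topology MeasureTheory

noncomputable section

/-- The parameters of a mixture of `K` Gaussians on `ℝ^D`: positive weights that sum to one,
means, and symmetric positive definite covariance matrices. -/
structure GaussianMixture (D K : ℕ) where
  weight : Fin K → ℝ
  mean : Fin K → EuclideanSpace ℝ (Fin D)
  cov : Fin K → Matrix (Fin D) (Fin D) ℝ
  weight_pos : ∀ k, 0 < weight k
  weight_sum : ∑ k, weight k = 1
  cov_posDef : ∀ k, (cov k).PosDef

/-- The density of the normal distribution with mean `μ` and covariance matrix `S`:
`(2π)^(-D/2) |S|^(-1/2) exp (-(x - μ)ᵀ S⁻¹ (x - μ) / 2)`. -/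
def gaussianDensity {D : ℕ} (μ : EuclideanSpace ℝ (Fin D)) (S : Matrix (Fin D) (Fin D) ℝ)
    (x : EuclideanSpace ℝ (Fin D)) : ℝ :=
  (2 * Real.pi) ^ (-(D : ℝ) / 2) * S.det ^ (-(1 : ℝ) / 2) *
    Real.exp (-(1 / 2) * inner ℝ (x - μ) (Matrix.toEuclideanCLM (𝕜 := ℝ) S⁻¹ (x - μ)))

/-- The density `p` of the mixture. -/
def GaussianMixture.density {D K : ℕ} (M : GaussianMixture D K)
    (x : EuclideanSpace ℝ (Fin D)) : ℝ :=
  ∑ k, M.weight k * gaussianDensity (M.mean k) (M.cov k) x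

/-- The height function `f = - ln p` of the mixture. -/
def GaussianMixture.potential {D K : ℕ} (M : GaussianMixture D K)
    (x : EuclideanSpace ℝ (Fin D)) : ℝ :=
  -Real.log (M.density x)

/-- The vector field `x ↦ -R(x)⁻¹ ∇f(x)` of the generalized gradient system of `f` with respect to
the metric `R`. -/
def gradField {D : ℕ} (f : EuclideanSpace ℝ (Fin D) → ℝ)
    (R : EuclideanSpace ℝ (Fin D) → Matrix (Fin D) (Fin D) ℝ) (x : EuclideanSpace ℝ (Fin D)) :
    EuclideanSpace ℝ (Fin D) :=
  -Matrix.toEuclideanCLM (𝕜 := ℝ) (R x)⁻¹ (gradient f x)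

/-- A trajectory, in forward time, of the generalized gradient system of `f` with respect to `R`:
a solution of `dx/dt = -R(x)⁻¹ ∇f(x)` on `[0, ∞)` (only the values at times `t ≥ 0` matter). -/
def IsTrajectory {D : ℕ} (f : EuclideanSpace ℝ (Fin D) → ℝ)
    (R : EuclideanSpace ℝ (Fin D) → Matrix (Fin D) (Fin D) ℝ)
    (γ : ℝ → EuclideanSpace ℝ (Fin D)) : Prop :=
  IsIntegralCurveOn γ (fun _ x => gradField f R x) (Ici 0)

/-- An equilibrium vector, or critical point, of `f`. -/
def IsEquilibrium {D : ℕ} (f : EuclideanSpace ℝ (Fin D) → ℝ) (x : EuclideanSpace ℝ (Fin D)) :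
    Prop :=
  gradient f x = 0

/-- The Hessian of `f` at `x`, as a linear operator: the derivative of the gradient. -/
def hessianOp {D : ℕ} (f : EuclideanSpace ℝ (Fin D) → ℝ) (x : EuclideanSpace ℝ (Fin D)) :
    Module.End ℝ (EuclideanSpace ℝ (Fin D)) :=
  (fderiv ℝ (gradient f) x : EuclideanSpace ℝ (Fin D) →ₗ[ℝ] EuclideanSpace ℝ (Fin D))

/-- A hyperbolic equilibrium vector: the Hessian has no zero eigenvalue. -/
def IsHyperbolicEquilibrium {D : ℕ} (f : EuclideanSpace ℝ (Fin D) → ℝ)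
    (x : EuclideanSpace ℝ (Fin D)) : Prop :=
  IsEquilibrium f x ∧ ¬ (hessianOp f x).HasEigenvalue 0

/-- A smooth function is a Morse function if all its equilibrium vectors are hyperbolic. -/
def IsMorse {D : ℕ} (f : EuclideanSpace ℝ (Fin D) → ℝ) : Prop :=
  ∀ x, IsEquilibrium f x → IsHyperbolicEquilibrium f x

/-- A stable equilibrium vector: a hyperbolic equilibrium vector at which all eigenvalues of the
(symmetric) Hessian are positive. -/
def IsStableEquilibrium {D : ℕ} (f : EuclideanSpace ℝ (Fin D) → ℝ)
    (x : EuclideanSpace ℝ (Fin D)) : Prop :=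
  IsHyperbolicEquilibrium f x ∧ ∀ c : ℝ, (hessianOp f x).HasEigenvalue c → 0 < c

/-- The basin cell of `e`: the closure of the set of initial points `x(0)` of trajectories that
converge to `e` as `t → ∞`. -/
def basinCell {D : ℕ} (f : EuclideanSpace ℝ (Fin D) → ℝ)
    (R : EuclideanSpace ℝ (Fin D) → Matrix (Fin D) (Fin D) ℝ) (e : EuclideanSpace ℝ (Fin D)) :
    Set (EuclideanSpace ℝ (Fin D)) :=
  closure {x | ∃ γ : ℝ → EuclideanSpace ℝ (Fin D),
    IsTrajectory f R γ ∧ γ 0 = x ∧ Tendsto γ atTop (𝓝 e)}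

/-- The condition number `‖A‖ ‖A⁻¹‖` of a matrix, in the operator norm of the Euclidean norm. -/
def conditionNumber {D : ℕ} (A : Matrix (Fin D) (Fin D) ℝ) : ℝ :=
  ‖Matrix.toEuclideanCLM (𝕜 := ℝ) A‖ * ‖Matrix.toEuclideanCLM (𝕜 := ℝ) A⁻¹‖

end

/-!
Along a trajectory `f` decreases, so the trajectory stays in a compact sublevel set; its cluster
points are critical points of `f`, and as these are isolated it converges to one of them.

Let `e` be a critical point with Hessian `H`. Since `A(e)` is positive definite, the form
`⟪H w, w⟫` decreases along the difference `w` of two trajectories that stay near `e`. If both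
converge to `e`, the form tends to `0`, so it is nonnegative at time `0`. Hence, if
`⟪H u, u⟫ < 0` for some `u`, every line in the direction `u` meets the local stable set of `e` (and
its closure) at most once, and this set is null by Fubini. As the flow is locally bi-Lipschitz,
the whole stable set of `e` is null.

Almost every point therefore flows to a nondegenerate minimum. The stable sets of the minima are
open, pairwise disjoint and locally finite, so their closures cover the space and overlap in null
sets only.
-/

section PositiveDefiniteOperators

variable {E : Type*} [NormedAddCommGroup E] [InnerProductSpace ℝ E] {T : E →L[ℝ] E}

/-- Positive definiteness of the quadratic form `v ↦ ⟪T v, v⟫`; the operator `T` need not be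
symmetric. -/
def IsPosDefOperator (T : E →L[ℝ] E) : Prop :=
  ∀ v, v ≠ 0 → 0 < inner ℝ (T v) v

namespace IsPosDefOperator

theorem inner_nonneg (hT : IsPosDefOperator T) (v : E) : 0 ≤ inner ℝ (T v) v := by
  rcases eq_or_ne v 0 with rfl | hv
  · simp
  · exact (hT v hv).le

theorem injective (hT : IsPosDefOperator T) : Function.Injective T := by
  refine (injective_iff_map_eq_zero T).2 fun v hv => ?_
  by_contra hne
  simpa [hv] using hT v hne

theorem exists_mul_sq_norm_le_inner [FiniteDimensional ℝ E] (hT : IsPosDefOperator T) :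
    ∃ c > 0, ∀ v, c * ‖v‖ ^ 2 ≤ inner ℝ (T v) v := by
  obtain ⟨c, hc, hmin⟩ := (isCompact_sphere (0 : E) 1).exists_forall_le'
    (f := fun v => inner ℝ (T v) v) (by fun_prop) fun v hv =>
      hT v (ne_zero_of_mem_unit_sphere (⟨v, hv⟩ : Metric.sphere (0 : E) 1))
  refine ⟨c, hc, fun v => ?_⟩
  rcases eq_or_ne v 0 with rfl | hv
  · simp
  have hv' : 0 < ‖v‖ := norm_pos_iff.2 hv
  have h_unit : c ≤ inner ℝ (T (‖v‖⁻¹ • v)) (‖v‖⁻¹ • v) :=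
    hmin _ (by simp [norm_smul, hv'.ne'])
  rw [map_smul, real_inner_smul_left, real_inner_smul_right, ← mul_assoc] at h_unit
  calc c * ‖v‖ ^ 2 ≤ ‖v‖⁻¹ * ‖v‖⁻¹ * inner ℝ (T v) v * ‖v‖ ^ 2 := by gcongr
    _ = inner ℝ (T v) v := by field_simp

end IsPosDefOperator

theorem isPosDefOperator_of_inner_nonneg (hsymm : (T : E →ₗ[ℝ] E).IsSymmetric)
    (hinj : Function.Injective T) (hT : ∀ v, 0 ≤ inner ℝ (T v) v) : IsPosDefOperator T := by
  intro v hv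
  refine (hT v).lt_of_ne' fun hzero => hv ((map_eq_zero_iff T hinj).1 ?_)
  have cauchy_schwarz := LinearMap.BilinForm.apply_sq_le_of_symm
    (innerₗ E ∘ₗ (T : E →ₗ[ℝ] E)) hT
    ⟨fun x y => by simpa [real_inner_comm] using hsymm x y⟩ v (T v)
  simpa [hzero] using cauchy_schwarz

theorem isPosDefOperator_of_hasEigenvalue_pos [FiniteDimensional ℝ E]
    (hsymm : (T : E →ₗ[ℝ] E).IsSymmetric)
    (hpos : ∀ c, Module.End.HasEigenvalue (T : E →ₗ[ℝ] E) c → 0 < c) : IsPosDefOperator T := by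
  intro v hv
  have : Nontrivial E := ⟨v, 0, hv⟩
  have hbdd : BddBelow (range fun x : {x : E // x ≠ 0} => inner ℝ (T x) (x : E) / ‖(x : E)‖ ^ 2) :=
    ⟨-‖T‖, by rintro _ ⟨x, rfl⟩; exact (abs_le.1 (T.rayleighQuotient_le_norm x)).1⟩
  have h := (hpos _ hsymm.hasEigenvalue_iInf_of_finiteDimensional).trans_le (ciInf_le hbdd ⟨v, hv⟩)
  exact (div_pos_iff_of_pos_right (by positivity)).1 h

end PositiveDefiniteOperators

section NullSets

variable {E : Type*} [NormedAddCommGroup E] [InnerProductSpace ℝ E] [FiniteDimensional ℝ E]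
  [MeasurableSpace E] [BorelSpace E]

theorem volume_eq_zero_of_dist_le_mul_dist {C : NNReal} {Φ : E → E} {s : Set E}
    (hΦ : ∀ x ∈ s, ∀ y ∈ s, dist x y ≤ C * dist (Φ x) (Φ y)) (hs : volume (Φ '' s) = 0) :
    volume s = 0 := by
  let d : ℝ := (Module.finrank ℝ E : ℝ)
  have hd : 0 ≤ d := Nat.cast_nonneg _
  have h_vol : (volume : Measure E) ≪ Measure.hausdorffMeasure d :=
    Measure.absolutelyContinuous_isAddHaarMeasure _ _
  have h_haus : (Measure.hausdorffMeasure d : Measure E) ≪ volume :=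
    Measure.absolutelyContinuous_isAddHaarMeasure _ _
  have hanti : AntilipschitzWith C (s.domRestrict Φ) :=
    AntilipschitzWith.of_le_mul_dist fun x y => hΦ x x.2 y y.2
  refine h_vol (le_antisymm ?_ zero_le)
  calc Measure.hausdorffMeasure d s
      = Measure.hausdorffMeasure d (univ : Set s) := by
        rw [← (isometry_subtype_coe (s := s)).hausdorffMeasure_image (.inl hd), image_univ,
          Subtype.range_coe]
    _ ≤ (C : ENNReal) ^ d * Measure.hausdorffMeasure d (s.domRestrict Φ '' univ) :=
        hanti.le_hausdorffMeasure_image hd univ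
    _ = 0 := by rw [image_univ, range_domRestrict, h_haus hs, mul_zero]

theorem volume_eq_zero_of_inner_sub_nonneg {H : E →L[ℝ] E} {s : Set E}
    (hs : ∀ x ∈ s, ∀ y ∈ s, 0 ≤ inner ℝ (H (x - y)) (x - y)) {u : E}
    (hu : inner ℝ (H u) u < 0) : volume s = 0 := by
  have h_closure : ∀ x ∈ closure s, ∀ y ∈ closure s, 0 ≤ inner ℝ (H (x - y)) (x - y) := by
    intro x hx y hy
    have h_closed : IsClosed {p : E × E | 0 ≤ inner ℝ (H (p.1 - p.2)) (p.1 - p.2)} :=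
      isClosed_le continuous_const (by fun_prop)
    have hxy : (x, y) ∈ closure (s ×ˢ s) := by
      rw [closure_prod_eq]
      exact ⟨hx, hy⟩
    exact closure_minimal (fun p hp => hs _ hp.1 _ hp.2) h_closed hxy
  have h_line : ∀ y, {t : ℝ | y + t • u ∈ closure s}.Subsingleton := by
    intro y a ha b hb
    by_contra hab
    have h_diff : y + a • u - (y + b • u) = (a - b) • u := by module
    have h_nonneg := h_closure _ ha _ hb
    rw [h_diff, map_smul, real_inner_smul_left, real_inner_smul_right, ← mul_assoc] at h_nonneg
    exact h_nonneg.not_gt (mul_neg_of_pos_of_neg (mul_self_pos.2 (sub_ne_zero.2 hab)) hu)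
  have h_ae : ∀ᵐ y ∂(volume : Measure E), y ∈ (closure s)ᶜ :=
    ae_mem_of_ae_add_linearMap_mem (LinearMap.toSpanSingleton ℝ E u) (volume : Measure ℝ) _
      isClosed_closure.measurableSet.compl fun y => by
        simpa [ae_iff] using! (h_line y).measure_zero volume
  exact measure_mono_null subset_closure (by simpa [ae_iff] using h_ae)

end NullSets

section ForwardSolutions

variable {E : Type*} [NormedAddCommGroup E] [NormedSpace ℝ E] {W W' : E → E} {γ γ' : ℝ → E}

/-- A solution of the autonomous equation `x' = W x` in forward time: its values at negative times
are arbitrary. -/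
abbrev IsForwardSolution (W : E → E) (γ : ℝ → E) : Prop :=
  IsIntegralCurveOn γ (fun _ => W) (Ici 0)

/-- The stable set of `e` under the equation `x' = W x`: the initial points of the forward
solutions that converge to `e`. -/
def stableSet (W : E → E) (e : E) : Set E :=
  {x | ∃ γ : ℝ → E, IsForwardSolution W γ ∧ γ 0 = x ∧ Tendsto γ atTop (𝓝 e)}

/-- The local stable set of `e` in `s` under the equation `x' = W x`: the initial points of the
forward solutions that stay in `s` and converge to `e`. -/
def localStableSet (W : E → E) (s : Set E) (e : E) : Set E :=
  {x | ∃ γ : ℝ → E, IsForwardSolution W γ ∧ γ 0 = x ∧ (∀ t, 0 ≤ t → γ t ∈ s) ∧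
    Tendsto γ atTop (𝓝 e)}

namespace IsForwardSolution

theorem hasDerivAt (hγ : IsForwardSolution W γ) {t : ℝ} (ht : 0 < t) :
    HasDerivAt γ (W (γ t)) t :=
  (hγ.isIntegralCurveAt (Ici_mem_nhds ht)).hasDerivAt

theorem comp_add_const (hγ : IsForwardSolution W γ) {s : ℝ} (hs : 0 ≤ s) :
    IsForwardSolution W (fun t => γ (t + s)) :=
  (hγ.comp_add s).mono fun t (ht : 0 ≤ t) => by
    simpa [mem_vadd_set_iff_neg_vadd_mem, add_comm] using add_nonneg ht hs

theorem congr_field (hγ : IsForwardSolution W γ) (h : ∀ t, 0 ≤ t → W (γ t) = W' (γ t)) :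
    IsForwardSolution W' γ := fun t ht => by
  simpa only [h t ht] using hγ t ht

theorem antitoneOn_comp {f : E → ℝ} (hf : Differentiable ℝ f)
    (hW : ∀ x, fderiv ℝ f x (W x) ≤ 0) (hγ : IsForwardSolution W γ) :
    AntitoneOn (f ∘ γ) (Ici 0) := by
  refine antitoneOn_of_hasDerivWithinAt_nonpos (convex_Ici 0)
    (f' := fun t => fderiv ℝ f (γ t) (W (γ t)))
    (hf.continuous.comp_continuousOn hγ.continuousOn) (fun t ht => ?_) fun t _ => hW (γ t)
  rw [interior_Ici] at ht
  exact ((hf (γ t)).hasFDerivAt.comp_hasDerivAt t (hγ.hasDerivAt ht)).hasDerivWithinAt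

end IsForwardSolution

theorem stableSet_subset_iUnion {s : Set E} {e : E} (hs : s ∈ 𝓝 e) :
    stableSet W e ⊆
      ⋃ n : ℕ, {x | ∃ γ, IsForwardSolution W γ ∧ γ 0 = x ∧ γ n ∈ localStableSet W s e} := by
  rintro x ⟨γ, hγ, hγ₀, hlim⟩
  obtain ⟨T, hT⟩ := eventually_atTop.1 (hlim.eventually hs)
  obtain ⟨n, hn⟩ := exists_nat_ge T
  refine mem_iUnion.2 ⟨n, γ, hγ, hγ₀, fun t => γ (t + n), hγ.comp_add_const n.cast_nonneg,
    congrArg γ (zero_add _), fun t ht => hT _ (by linarith), ?_⟩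
  exact hlim.comp (tendsto_atTop_add_const_right atTop _ tendsto_id)

variable {K : NNReal}

theorem dist_integralCurve_le_mul_exp (hW : LipschitzWith K W) {T : ℝ} (hT : 0 ≤ T)
    (hγ : IsIntegralCurveOn γ (fun _ => W) (Icc 0 T))
    (hγ' : IsIntegralCurveOn γ' (fun _ => W) (Icc 0 T)) :
    dist (γ T) (γ' T) ≤ dist (γ 0) (γ' 0) * Real.exp (K * T) := by
  have right_deriv : ∀ {α : ℝ → E}, IsIntegralCurveOn α (fun _ => W) (Icc 0 T) →
      ∀ s ∈ Ico 0 T, HasDerivWithinAt α (W (α s)) (Ici s) s := fun hα s hs =>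
    (hα s (Ico_subset_Icc_self hs)).mono_of_mem_nhdsWithin
      (mem_of_superset (Icc_mem_nhdsGE hs.2) (Icc_subset_Icc_left hs.1))
  simpa using dist_le_of_trajectories_ODE (v := fun _ => W) (fun _ => hW) hγ.continuousOn
    (right_deriv hγ) hγ'.continuousOn (right_deriv hγ') le_rfl T (right_mem_Icc.2 hT)

theorem isIntegralCurveOn_reverse {T : ℝ} (hγ : IsIntegralCurveOn γ (fun _ => W) (Icc 0 T)) :
    IsIntegralCurveOn (fun t => γ (T - t)) (fun _ => -W) (Icc 0 T) := by
  intro t ht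
  have h_time : HasDerivWithinAt (fun t : ℝ => T - t) (-1) (Icc 0 T) t :=
    ((hasDerivAt_id t).const_sub T).hasDerivWithinAt
  have h_maps : MapsTo (fun t : ℝ => T - t) (Icc 0 T) (Icc 0 T) :=
    fun s hs => ⟨by linarith [hs.2], by linarith [hs.1]⟩
  simpa using! (hγ (T - t) (h_maps ht)).scomp t h_time h_maps

theorem dist_integralCurve_zero_le_mul_exp (hW : LipschitzWith K W) {T : ℝ} (hT : 0 ≤ T)
    (hγ : IsIntegralCurveOn γ (fun _ => W) (Icc 0 T))
    (hγ' : IsIntegralCurveOn γ' (fun _ => W) (Icc 0 T)) :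
    dist (γ 0) (γ' 0) ≤ dist (γ T) (γ' T) * Real.exp (K * T) := by
  simpa using dist_integralCurve_le_mul_exp hW.neg hT (isIntegralCurveOn_reverse hγ)
    (isIntegralCurveOn_reverse hγ')

theorem isForwardSolution_of_eqOn {α : ℕ → ℝ → E}
    (hα : ∀ n : ℕ, IsIntegralCurveOn (α n) (fun _ => W) (Icc 0 n))
    (hγ : ∀ n : ℕ, EqOn γ (α n) (Icc 0 n)) : IsForwardSolution W γ := by
  intro t ht
  obtain ⟨n, hn⟩ := exists_nat_gt t
  have h_nhds : Icc (0 : ℝ) n ∈ 𝓝[Ici 0] t := by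
    rw [← Ici_inter_Iic]
    exact inter_mem self_mem_nhdsWithin (mem_nhdsWithin_of_mem_nhds (Iic_mem_nhds hn))
  have ht' : t ∈ Icc (0 : ℝ) n := ⟨ht, hn.le⟩
  have h_deriv := (hα n t ht').congr (hγ n) (hγ n ht')
  rw [← hγ n ht'] at h_deriv
  exact h_deriv.mono_of_mem_nhdsWithin h_nhds

theorem exists_isForwardSolution_of_lipschitzWith [CompleteSpace E] (hW : LipschitzWith K W)
    {L : NNReal} (hL : ∀ x, ‖W x‖ ≤ L) (x : E) : ∃ γ, IsForwardSolution W γ ∧ γ 0 = x := by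
  have h_finite : ∀ n : ℕ, ∃ α : ℝ → E, α 0 = x ∧
      IsIntegralCurveOn α (fun _ => W) (Icc 0 (n : ℝ)) := fun n =>
    have h_picard : IsPicardLindelof (fun _ => W)
        (⟨0, left_mem_Icc.2 n.cast_nonneg⟩ : Icc (0 : ℝ) n) x (L * n) 0 L K :=
      IsPicardLindelof.of_time_independent (fun y _ => hL y) hW.lipschitzOnWith (by simp)
    h_picard.exists_eq_forall_mem_Icc_hasDerivWithinAt₀
  choose α hα_zero hα using h_finite
  have h_agree : ∀ m n : ℕ, EqOn (α m) (α n) (Icc 0 m ∩ Icc 0 n) := by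
    rintro m n t ⟨hm, hn⟩
    have := dist_integralCurve_le_mul_exp hW hm.1 ((hα m).mono (Icc_subset_Icc_right hm.2))
      ((hα n).mono (Icc_subset_Icc_right hn.2))
    rw [hα_zero, hα_zero, dist_self, zero_mul] at this
    exact dist_le_zero.1 this
  refine ⟨fun t => α ⌈t⌉₊ t, isForwardSolution_of_eqOn hα fun n t ht => ?_, by simp [hα_zero]⟩
  exact h_agree _ _ ⟨⟨ht.1, Nat.le_ceil t⟩, ht⟩

end ForwardSolutions

section Hessians

variable {E : Type*} [NormedAddCommGroup E] [InnerProductSpace ℝ E] [CompleteSpace E] {f : E → ℝ}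

/-- The Hessian of `f` at `x`, as the derivative of the gradient. -/
noncomputable abbrev hessian (f : E → ℝ) (x : E) : E →L[ℝ] E :=
  fderiv ℝ (gradient f) x

/-- The critical points of `f` are isolated from one another. -/
def HasIsolatedCriticalPoints (f : E → ℝ) : Prop :=
  ∀ e, gradient f e = 0 → ∀ᶠ y in 𝓝[≠] e, gradient f y ≠ 0

/-- The Morse condition: the Hessian is nondegenerate at each critical point. -/
def HasNondegenerateCriticalPoints (f : E → ℝ) : Prop :=
  ∀ e, gradient f e = 0 → Function.Injective (hessian f e)

/-- A critical point with positive definite Hessian. -/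
def IsNondegenerateMin (f : E → ℝ) (e : E) : Prop :=
  gradient f e = 0 ∧ IsPosDefOperator (hessian f e)

theorem contDiff_one_gradient (hf : ContDiff ℝ 2 f) : ContDiff ℝ 1 (gradient f) :=
  (InnerProductSpace.toDual ℝ E).symm.toContinuousLinearEquiv.contDiff.comp
    (hf.fderiv_right (m := 1) (by norm_num))

theorem hasFDerivAt_gradient (hf : ContDiff ℝ 2 f) (x : E) :
    HasFDerivAt (gradient f) (hessian f x) x :=
  ((contDiff_one_gradient hf).differentiable one_ne_zero x).hasFDerivAt

theorem inner_hessian_eq_fderiv_fderiv (hf : ContDiff ℝ 2 f) (x v w : E) :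
    inner ℝ (hessian f x v) w = fderiv ℝ (fderiv ℝ f) x v w := by
  have h_fderiv : HasFDerivAt (fderiv ℝ f) (fderiv ℝ (fderiv ℝ f) x) x :=
    ((hf.fderiv_right (m := 1) (by norm_num)).differentiable one_ne_zero x).hasFDerivAt
  have h_gradient : HasFDerivAt (gradient f) _ x :=
    (InnerProductSpace.toDual ℝ E).symm.toContinuousLinearEquiv.hasFDerivAt.comp x h_fderiv
  rw [hessian, h_gradient.fderiv]
  exact InnerProductSpace.toDual_symm_apply

theorem isSymmetric_hessian (hf : ContDiff ℝ 2 f) (x : E) :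
    (hessian f x : E →ₗ[ℝ] E).IsSymmetric := by
  intro v w
  have h := (hf.contDiffAt.isSymmSndFDerivAt (x := x) (by simp)).eq v w
  rw [real_inner_comm ((hessian f x : E →ₗ[ℝ] E) w)]
  simpa only [ContinuousLinearMap.coe_coe, inner_hessian_eq_fderiv_fderiv hf] using h

theorem exists_inner_hessian_neg (hf : ContDiff ℝ 2 f) (hM : HasNondegenerateCriticalPoints f)
    {e : E} (he : gradient f e = 0) (hmin : ¬ IsNondegenerateMin f e) :
    ∃ u, inner ℝ (hessian f e u) u < 0 := by
  by_contra! h_nonneg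
  exact hmin ⟨he, isPosDefOperator_of_inner_nonneg (isSymmetric_hessian hf e) (hM e he) h_nonneg⟩

theorem IsNondegenerateMin.eventually_inner_gradient_sub_pos [FiniteDimensional ℝ E]
    (hf : ContDiff ℝ 2 f) {e : E} (he : IsNondegenerateMin f e) :
    ∀ᶠ y in 𝓝[≠] e, 0 < inner ℝ (gradient f y) (y - e) := by
  obtain ⟨c, hc, hcoer⟩ := he.2.exists_mul_sq_norm_le_inner
  have h_approx := (hasFDerivAt_gradient hf e).isLittleO.def (half_pos hc)
  filter_upwards [nhdsWithin_le_nhds h_approx, self_mem_nhdsWithin] with y hy hne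
  set w := y - e
  have hw : 0 < ‖w‖ := norm_pos_iff.2 (sub_ne_zero.2 hne)
  set ρ := gradient f y - gradient f e - hessian f e w with hρ
  have h_error : -(c / 2 * ‖w‖ ^ 2) ≤ inner ℝ ρ w := by
    refine (abs_le.1 ((abs_real_inner_le_norm ρ w).trans ?_)).1
    rw [sq, ← mul_assoc]
    gcongr
  have h_split : inner ℝ (gradient f y) w = inner ℝ (hessian f e w) w + inner ℝ ρ w := by
    rw [← inner_add_left, hρ, he.1]
    congr 1
    abel
  have : 0 < c * ‖w‖ ^ 2 := by positivity
  linarith [hcoer w]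

theorem IsNondegenerateMin.eventually_lt [FiniteDimensional ℝ E] (hf : ContDiff ℝ 2 f) {e : E}
    (he : IsNondegenerateMin f e) : ∀ᶠ y in 𝓝[≠] e, f e < f y := by
  obtain ⟨r, hr, hball⟩ := Metric.mem_nhdsWithin_iff.1 (he.eventually_inner_gradient_sub_pos hf)
  filter_upwards [nhdsWithin_le_nhds (Metric.ball_mem_nhds e hr), self_mem_nhdsWithin]
    with y hy hne
  set w := y - e
  have hw : w ≠ 0 := sub_ne_zero.2 hne
  have h_deriv : ∀ t : ℝ, HasDerivAt (fun t => f (e + t • w))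
      (inner ℝ (gradient f (e + t • w)) w) t := fun t => by
    have h_line : HasDerivAt (fun t : ℝ => e + t • w) w t := by
      simpa using ((hasDerivAt_id t).smul_const w).const_add e
    rw [inner_gradient_left]
    exact (hf.differentiable two_ne_zero _).hasFDerivAt.comp_hasDerivAt t h_line
  have h_pos : ∀ t ∈ Ioo (0 : ℝ) 1, 0 < inner ℝ (gradient f (e + t • w)) w := by
    intro t ht
    have h_mem : e + t • w ∈ Metric.ball e r ∩ {e}ᶜ := by
      refine ⟨?_, by simp [hw, ht.1.ne']⟩
      rw [Metric.mem_ball, dist_eq_norm] at hy ⊢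
      calc ‖e + t • w - e‖ = t * ‖w‖ := by
            rw [add_sub_cancel_left, norm_smul, Real.norm_of_nonneg ht.1.le]
        _ ≤ ‖w‖ := mul_le_of_le_one_left (norm_nonneg w) ht.2.le
        _ < r := hy
    have h_inner : 0 < inner ℝ (gradient f (e + t • w)) (e + t • w - e) := hball h_mem
    rw [add_sub_cancel_left, real_inner_smul_right] at h_inner
    exact pos_of_mul_pos_right h_inner ht.1.le
  have h_mono : StrictMonoOn (fun t : ℝ => f (e + t • w)) (Icc 0 1) :=
    strictMonoOn_of_hasDerivWithinAt_pos (convex_Icc 0 1)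
      (fun t _ => (h_deriv t).continuousAt.continuousWithinAt)
      (fun t _ => (h_deriv t).hasDerivWithinAt) (by simpa only [interior_Icc] using h_pos)
  simpa [w] using h_mono (left_mem_Icc.2 zero_le_one) (right_mem_Icc.2 zero_le_one) one_pos

theorem HasNondegenerateCriticalPoints.hasIsolatedCriticalPoints [FiniteDimensional ℝ E]
    (hM : HasNondegenerateCriticalPoints f) (hf : ContDiff ℝ 2 f) :
    HasIsolatedCriticalPoints f := by
  intro e he
  obtain ⟨C, -, hC⟩ := LinearMap.exists_antilipschitzWith (hessian f e : E →ₗ[ℝ] E)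
    (LinearMap.ker_eq_bot.2 (hM e he))
  exact (hasFDerivAt_gradient hf e).eventually_ne ⟨C, hC⟩

theorem HasIsolatedCriticalPoints.finite_inter (hiso : HasIsolatedCriticalPoints f)
    (hf : Continuous (gradient f)) {k : Set E} (hk : IsCompact k) :
    ({e | gradient f e = 0} ∩ k).Finite := by
  by_contra h_infinite
  obtain ⟨z, -, hz⟩ := Set.Infinite.exists_accPt_of_subset_isCompact h_infinite hk
    inter_subset_right
  have h_freq : ∃ᶠ y in 𝓝[≠] z, gradient f y = 0 :=
    (accPt_iff_frequently_nhdsNE.1 hz).mono fun y hy => hy.1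
  have hz_crit : gradient f z = 0 :=
    (isClosed_eq hf continuous_const).mem_of_frequently_of_tendsto
      (h_freq.filter_mono nhdsWithin_le_nhds) tendsto_id
  exact h_freq (hiso z hz_crit)

theorem HasIsolatedCriticalPoints.countable [SigmaCompactSpace E]
    (hiso : HasIsolatedCriticalPoints f) (hf : Continuous (gradient f)) :
    {e | gradient f e = 0}.Countable := by
  rw [← inter_univ {e | gradient f e = 0}, ← iUnion_compactCovering E, inter_iUnion]
  exact countable_iUnion fun n => (hiso.finite_inter hf (isCompact_compactCovering E n)).countable

end Hessians

section GradientSystems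

theorem forall_ge_lt_of_forall_ge_ne {g : ℝ → ℝ} {t₀ c : ℝ} (hg : ContinuousOn g (Ici t₀))
    (h₀ : g t₀ < c) (hne : ∀ t, t₀ ≤ t → g t ≠ c) : ∀ t, t₀ ≤ t → g t < c := by
  intro t ht
  by_contra! hge
  obtain ⟨s, hs, hsc⟩ := intermediate_value_Icc ht (hg.mono Icc_subset_Ici_self) ⟨h₀.le, hge⟩
  exact hne s hs.1 hsc

variable {E : Type*} [NormedAddCommGroup E] [InnerProductSpace ℝ E] [FiniteDimensional ℝ E]

/-- The vector field `x ↦ -A(x) ∇f(x)`; it is the field of steepest descent of `f` for the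
Riemannian metric `R` when `A(x) = R(x)⁻¹`. -/
noncomputable def descentField (f : E → ℝ) (A : E → E →L[ℝ] E) (x : E) : E :=
  -A x (gradient f x)

/-- The standing assumptions on the system `x' = -A(x) ∇f(x)`: the potential `f` is proper from
below, and the operators `A(x)` are positive definite but not necessarily symmetric. -/
structure IsProperGradientSystem (f : E → ℝ) (A : E → E →L[ℝ] E) : Prop where
  contDiff_potential : ContDiff ℝ 2 f
  contDiff_operator : ContDiff ℝ 1 A
  isPosDefOperator : ∀ x, IsPosDefOperator (A x)
  isCompact_sublevel : ∀ c, IsCompact {x | f x ≤ c}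

variable {f : E → ℝ} {A : E → E →L[ℝ] E} {γ γ' : ℝ → E}

theorem fderiv_descentField (x : E) :
    fderiv ℝ f x (descentField f A x) = -inner ℝ (A x (gradient f x)) (gradient f x) := by
  rw [descentField, map_neg, ← inner_gradient_left, real_inner_comm]

namespace IsProperGradientSystem

variable (S : IsProperGradientSystem f A)

include S

theorem contDiff_descentField : ContDiff ℝ 1 (descentField f A) :=
  (S.contDiff_operator.clm_apply (contDiff_one_gradient S.contDiff_potential)).neg

theorem fderiv_descentField_nonpos (x : E) : fderiv ℝ f x (descentField f A x) ≤ 0 := by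
  rw [fderiv_descentField, neg_nonpos]
  exact (S.isPosDefOperator x).inner_nonneg _

theorem fderiv_descentField_neg {x : E} (hx : gradient f x ≠ 0) :
    fderiv ℝ f x (descentField f A x) < 0 := by
  rw [fderiv_descentField, neg_lt_zero]
  exact S.isPosDefOperator x _ hx

theorem antitoneOn (hγ : IsForwardSolution (descentField f A) γ) :
    AntitoneOn (f ∘ γ) (Ici 0) :=
  hγ.antitoneOn_comp (S.contDiff_potential.differentiable two_ne_zero) S.fderiv_descentField_nonpos

theorem apply_le_apply_zero (hγ : IsForwardSolution (descentField f A) γ) {t : ℝ} (ht : 0 ≤ t) :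
    f (γ t) ≤ f (γ 0) :=
  S.antitoneOn hγ self_mem_Ici ht ht

-- Multiplying the field by a bump function that equals `1` on the sublevel set makes it globally
-- Lipschitz; `f` still decreases along the new field, so that solutions starting in the sublevel
-- set never see the difference.
theorem exists_lipschitzWith_field (c : ℝ) : ∃ (W : E → E) (K L : NNReal), LipschitzWith K W ∧
    (∀ x, ‖W x‖ ≤ L) ∧ ∀ γ, f (γ 0) ≤ c →
      (IsForwardSolution W γ ↔ IsForwardSolution (descentField f A) γ) := by
  obtain ⟨r, hr⟩ := (S.isCompact_sublevel c).isBounded.subset_closedBall 0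
  let χ : ContDiffBump (0 : E) :=
    ⟨max r 1, max r 1 + 1, lt_max_of_lt_right one_pos, lt_add_one _⟩
  let W : E → E := fun x => χ x • descentField f A x
  have hW : ContDiff ℝ 1 W := χ.contDiff.smul S.contDiff_descentField
  have h_supp : HasCompactSupport W := χ.hasCompactSupport.smul_right
  have hW_eq : ∀ x, f x ≤ c → W x = descentField f A x := by
    intro x hx
    have : χ x = 1 := χ.one_of_mem_closedBall
      (Metric.closedBall_subset_closedBall (le_max_left _ _) (hr hx))
    simp [W, this]
  have hW_nonpos : ∀ x, fderiv ℝ f x (W x) ≤ 0 := by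
    intro x
    rw [map_smul]
    exact mul_nonpos_of_nonneg_of_nonpos χ.nonneg (S.fderiv_descentField_nonpos x)
  obtain ⟨K, hK⟩ := hW.lipschitzWith_of_hasCompactSupport h_supp one_ne_zero
  obtain ⟨L, hL⟩ := h_supp.exists_bound_of_continuous hW.continuous
  refine ⟨W, K, L.toNNReal, hK, fun x => (hL x).trans (Real.le_coe_toNNReal L), fun γ h₀ =>
    ⟨fun hγ => hγ.congr_field fun t ht => hW_eq _ ?_,
      fun hγ => hγ.congr_field fun t ht => (hW_eq _ ?_).symm⟩⟩
  · exact (hγ.antitoneOn_comp (S.contDiff_potential.differentiable two_ne_zero) hW_nonpos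
      self_mem_Ici ht ht).trans h₀
  · exact (S.apply_le_apply_zero hγ ht).trans h₀

theorem exists_isForwardSolution (x : E) :
    ∃ γ, IsForwardSolution (descentField f A) γ ∧ γ 0 = x := by
  obtain ⟨W, K, L, hW, hL, h_iff⟩ := S.exists_lipschitzWith_field (f x)
  obtain ⟨γ, hγ, rfl⟩ := exists_isForwardSolution_of_lipschitzWith hW hL x
  exact ⟨γ, (h_iff γ le_rfl).1 hγ, rfl⟩

theorem exists_dist_le_mul_exp (c : ℝ) : ∃ K : NNReal, ∀ γ γ' : ℝ → E,
    IsForwardSolution (descentField f A) γ → IsForwardSolution (descentField f A) γ' →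
    f (γ 0) ≤ c → f (γ' 0) ≤ c → ∀ t, 0 ≤ t →
      dist (γ t) (γ' t) ≤ dist (γ 0) (γ' 0) * Real.exp (K * t) ∧
      dist (γ 0) (γ' 0) ≤ dist (γ t) (γ' t) * Real.exp (K * t) := by
  obtain ⟨W, K, L, hW, -, h_iff⟩ := S.exists_lipschitzWith_field c
  refine ⟨K, fun γ γ' hγ hγ' h₀ h₀' t ht => ?_⟩
  have hγW := ((h_iff γ h₀).2 hγ).mono (Icc_subset_Ici_self : Icc 0 t ⊆ Ici 0)
  have hγW' := ((h_iff γ' h₀').2 hγ').mono (Icc_subset_Ici_self : Icc 0 t ⊆ Ici 0)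
  exact ⟨dist_integralCurve_le_mul_exp hW ht hγW hγW',
    dist_integralCurve_zero_le_mul_exp hW ht hγW hγW'⟩

theorem eqOn_of_apply_zero_eq (hγ : IsForwardSolution (descentField f A) γ)
    (hγ' : IsForwardSolution (descentField f A) γ') (h₀ : γ 0 = γ' 0) : EqOn γ γ' (Ici 0) := by
  intro t ht
  obtain ⟨K, hK⟩ := S.exists_dist_le_mul_exp (f (γ 0))
  have h_dist := (hK γ γ' hγ hγ' le_rfl (h₀ ▸ le_rfl) t ht).1
  rw [h₀, dist_self, zero_mul] at h_dist
  exact dist_le_zero.1 h_dist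

theorem isBounded_image (hγ : IsForwardSolution (descentField f A) γ) :
    Bornology.IsBounded (γ '' Ici 0) := by
  refine (S.isCompact_sublevel (f (γ 0))).isBounded.subset ?_
  rintro _ ⟨t, ht, rfl⟩
  exact S.apply_le_apply_zero hγ ht

theorem eventually_apply_mem (hγ : IsForwardSolution (descentField f A) γ) {t : ℝ} (ht : 0 ≤ t)
    {U : Set E} (hU : U ∈ 𝓝 (γ t)) :
    ∀ᶠ y in 𝓝 (γ 0), ∀ ψ, IsForwardSolution (descentField f A) ψ → ψ 0 = y → ψ t ∈ U := by
  obtain ⟨K, hK⟩ := S.exists_dist_le_mul_exp (f (γ 0) + 1)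
  obtain ⟨ε, hε, hball⟩ := Metric.mem_nhds_iff.1 hU
  have h_level : ∀ᶠ y in 𝓝 (γ 0), f y < f (γ 0) + 1 :=
    S.contDiff_potential.continuous.continuousAt.eventually_lt_const (lt_add_one _)
  filter_upwards [h_level, Metric.ball_mem_nhds (γ 0) (div_pos hε (Real.exp_pos (K * t)))]
    with y hy hy_ball ψ hψ hψ₀
  subst hψ₀
  refine hball ((hK ψ γ hψ hγ hy.le (lt_add_one _).le t ht).1.trans_lt ?_)
  exact (lt_div_iff₀ (Real.exp_pos _)).1 hy_ball

theorem exists_lt_of_gradient_ne_zero (hγ : IsForwardSolution (descentField f A) γ)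
    (h₀ : gradient f (γ 0) ≠ 0) : ∃ t, 0 ≤ t ∧ f (γ t) < f (γ 0) := by
  by_contra! h_ge
  have h_const : ∀ t ∈ Ici (0 : ℝ), (f ∘ γ) t = f (γ 0) := fun t ht =>
    (S.apply_le_apply_zero hγ ht).antisymm (h_ge t ht)
  have h_deriv : HasDerivWithinAt (f ∘ γ) (fderiv ℝ f (γ 0) (descentField f A (γ 0))) (Ici 0) 0 :=
    (S.contDiff_potential.differentiable two_ne_zero _).hasFDerivAt.comp_hasDerivWithinAt 0
      (hγ 0 self_mem_Ici)
  have h_deriv_zero : HasDerivWithinAt (f ∘ γ) 0 (Ici 0) 0 :=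
    (hasDerivWithinAt_const (0 : ℝ) (Ici 0) (f (γ 0))).congr h_const rfl
  exact (S.fderiv_descentField_neg h₀).ne
    ((uniqueDiffOn_Ici (0 : ℝ) 0 self_mem_Ici).eq_deriv _ h_deriv h_deriv_zero)

theorem le_apply_of_mapClusterPt {z : E} (hγ : IsForwardSolution (descentField f A) γ)
    (hz : MapClusterPt z atTop γ) {t : ℝ} (ht : 0 ≤ t) : f z ≤ f (γ t) := by
  have h_closed : IsClosed {y | f y ≤ f (γ t)} :=
    isClosed_le S.contDiff_potential.continuous continuous_const
  refine h_closed.mem_of_mapClusterPt hz ?_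
  filter_upwards [eventually_ge_atTop t] with s hs
  exact S.antitoneOn hγ ht (ht.trans hs) hs

theorem gradient_eq_zero_of_mapClusterPt {z : E} (hγ : IsForwardSolution (descentField f A) γ)
    (hz : MapClusterPt z atTop γ) : gradient f z = 0 := by
  by_contra hne
  obtain ⟨ψ, hψ, rfl⟩ := S.exists_isForwardSolution z
  obtain ⟨s, hs, hlt⟩ := S.exists_lt_of_gradient_ne_zero hψ hne
  have h_near := S.eventually_apply_mem hψ hs
    ((isOpen_lt S.contDiff_potential.continuous continuous_const).mem_nhds hlt)
  obtain ⟨t, ht_near, ht⟩ := ((hz.frequently h_near).and_eventually (eventually_ge_atTop 0)).exists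
  have h_lt : f (γ (s + t)) < f (ψ 0) := ht_near _ (hγ.comp_add_const ht) (by rw [zero_add])
  exact h_lt.not_ge (S.le_apply_of_mapClusterPt hγ hz (add_nonneg hs ht))

theorem eventually_dist_ne {e : E} {ε : ℝ} (hγ : IsForwardSolution (descentField f A) γ)
    (hε : ∀ z ∈ Metric.sphere e ε, gradient f z ≠ 0) : ∀ᶠ t in atTop, dist (γ t) e ≠ ε := by
  by_contra h_freq
  obtain ⟨z, hz, hz_cluster⟩ := (isCompact_sphere e ε).exists_mapClusterPt_of_frequently
    (l := atTop) (f := γ) (by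
      simpa only [not_eventually, not_not, Metric.mem_sphere] using h_freq)
  exact hε z hz (S.gradient_eq_zero_of_mapClusterPt hγ hz_cluster)

theorem tendsto_of_mapClusterPt (hiso : HasIsolatedCriticalPoints f) {e : E}
    (hγ : IsForwardSolution (descentField f A) γ) (he : MapClusterPt e atTop γ) :
    Tendsto γ atTop (𝓝 e) := by
  obtain ⟨ρ, hρ, hball⟩ := Metric.mem_nhdsWithin_iff.1
    (hiso e (S.gradient_eq_zero_of_mapClusterPt hγ he))
  refine Metric.tendsto_nhds.2 fun ε' hε' => ?_
  obtain ⟨ε, hε, hε_lt⟩ := exists_between (lt_min hε' hρ)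
  have h_sphere : ∀ z ∈ Metric.sphere e ε, gradient f z ≠ 0 := fun z hz =>
    hball ⟨Metric.mem_ball.2 (hz.trans_lt (hε_lt.trans_le (min_le_right _ _))),
      Metric.ne_of_mem_sphere hz hε.ne'⟩
  obtain ⟨T, hT⟩ :=
    eventually_atTop.1 ((S.eventually_dist_ne hγ h_sphere).and (eventually_ge_atTop 0))
  obtain ⟨t₀, ht₀, hT₀⟩ :=
    ((he.frequently (Metric.ball_mem_nhds e hε)).and_eventually (eventually_ge_atTop T)).exists
  have h_cont : ContinuousOn (fun t => dist (γ t) e) (Ici t₀) :=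
    (continuous_id.dist continuous_const).comp_continuousOn
      (hγ.continuousOn.mono (Ici_subset_Ici.2 (hT t₀ hT₀).2))
  have h_stay := forall_ge_lt_of_forall_ge_ne h_cont ht₀ fun t ht => (hT t (hT₀.trans ht)).1
  filter_upwards [eventually_ge_atTop t₀] with t ht
  exact (h_stay t ht).trans (hε_lt.trans_le (min_le_left _ _))

theorem exists_tendsto (hiso : HasIsolatedCriticalPoints f)
    (hγ : IsForwardSolution (descentField f A) γ) :
    ∃ e, gradient f e = 0 ∧ Tendsto γ atTop (𝓝 e) := by
  have h_sublevel : ∀ᶠ t in atTop, γ t ∈ {x | f x ≤ f (γ 0)} := by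
    filter_upwards [eventually_ge_atTop 0] with t ht using S.apply_le_apply_zero hγ ht
  obtain ⟨e, -, he⟩ :=
    (S.isCompact_sublevel (f (γ 0))).exists_mapClusterPt_of_frequently h_sublevel.frequently
  exact ⟨e, S.gradient_eq_zero_of_mapClusterPt hγ he, S.tendsto_of_mapClusterPt hiso hγ he⟩

end IsProperGradientSystem

end GradientSystems

section HyperbolicEquilibria

variable {E : Type*} [NormedAddCommGroup E] [InnerProductSpace ℝ E] {H : E →L[ℝ] E} {W : E → E}
  {γ γ' : ℝ → E} {s : Set E} {e : E}

theorem antitoneOn_inner_sub (hH : (H : E →ₗ[ℝ] E).IsSymmetric)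
    (hs : ∀ x ∈ s, ∀ y ∈ s, inner ℝ (H (x - y)) (W x - W y) ≤ 0)
    (hγ : IsForwardSolution W γ) (hγ' : IsForwardSolution W γ')
    (hγs : ∀ t, 0 ≤ t → γ t ∈ s) (hγs' : ∀ t, 0 ≤ t → γ' t ∈ s) :
    AntitoneOn (fun t => inner ℝ (H (γ t - γ' t)) (γ t - γ' t)) (Ici 0) := by
  have h_cont : ContinuousOn (fun t => γ t - γ' t) (Ici 0) :=
    hγ.continuousOn.sub hγ'.continuousOn
  refine antitoneOn_of_hasDerivWithinAt_nonpos (convex_Ici 0)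
    (f' := fun t => 2 * inner ℝ (H (γ t - γ' t)) (W (γ t) - W (γ' t)))
    ((H.continuous.comp_continuousOn h_cont).inner h_cont) (fun t ht => ?_) fun t ht => ?_
  · rw [interior_Ici] at ht
    have h_diff := (hγ.hasDerivAt ht).sub (hγ'.hasDerivAt ht)
    have h_deriv := (H.hasFDerivAt.comp_hasDerivAt t h_diff).inner ℝ h_diff
    refine (h_deriv.congr_deriv ?_).hasDerivWithinAt
    have h_symm := hH (W (γ t) - W (γ' t)) (γ t - γ' t)
    simp only [ContinuousLinearMap.coe_coe] at h_symm
    simp only [Function.comp_apply, Pi.sub_apply]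
    rw [h_symm, real_inner_comm, two_mul]
  · rw [interior_Ici] at ht
    linarith [hs _ (hγs t ht.le) _ (hγs' t ht.le)]

theorem inner_sub_nonneg_of_mem_localStableSet (hH : (H : E →ₗ[ℝ] E).IsSymmetric)
    (hs : ∀ x ∈ s, ∀ y ∈ s, inner ℝ (H (x - y)) (W x - W y) ≤ 0) {x y : E}
    (hx : x ∈ localStableSet W s e) (hy : y ∈ localStableSet W s e) :
    0 ≤ inner ℝ (H (x - y)) (x - y) := by
  obtain ⟨γ, hγ, rfl, hγs, hγ_lim⟩ := hx
  obtain ⟨γ', hγ', rfl, hγs', hγ_lim'⟩ := hy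
  have h_diff : Tendsto (fun t => γ t - γ' t) atTop (𝓝 0) := by
    simpa using hγ_lim.sub hγ_lim'
  have h_lim : Tendsto (fun t => inner ℝ (H (γ t - γ' t)) (γ t - γ' t)) atTop (𝓝 0) := by
    simpa using ((H.continuous.tendsto 0).comp h_diff).inner (𝕜 := ℝ) h_diff
  refine le_of_tendsto h_lim ?_
  filter_upwards [eventually_ge_atTop 0] with t ht
  exact antitoneOn_inner_sub hH hs hγ hγ' hγs hγs' self_mem_Ici ht ht

variable [FiniteDimensional ℝ E]

theorem exists_ball_inner_sub_nonpos {T : E →L[ℝ] E} (hW : HasStrictFDerivAt W T e)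
    (hT : ∀ v, v ≠ 0 → inner ℝ (H v) (T v) < 0) :
    ∃ r > 0, ∀ x ∈ Metric.ball e r, ∀ y ∈ Metric.ball e r,
      inner ℝ (H (x - y)) (W x - W y) ≤ 0 := by
  have h_posDef : IsPosDefOperator (-(ContinuousLinearMap.adjoint T ∘L H)) := fun v hv => by
    simpa [ContinuousLinearMap.adjoint_inner_left] using hT v hv
  obtain ⟨c, hc, h_coer⟩ := h_posDef.exists_mul_sq_norm_le_inner
  have hε : 0 < c / (‖H‖ + 1) := by positivity
  obtain ⟨r, hr, hball⟩ := Metric.eventually_nhds_iff_ball.1 (hW.isLittleO.def hε)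
  refine ⟨r, hr, fun x hx y hy => ?_⟩
  have h_approx := hball (x, y) (by rw [← ball_prod_same]; exact ⟨hx, hy⟩)
  dsimp only at h_approx
  set w := x - y
  set ρ := W x - W y - T w with hρ
  have h_error : inner ℝ (H w) ρ ≤ c * ‖w‖ ^ 2 := by
    calc inner ℝ (H w) ρ ≤ ‖H w‖ * ‖ρ‖ := real_inner_le_norm _ _
      _ ≤ (‖H‖ + 1) * ‖w‖ * (c / (‖H‖ + 1) * ‖w‖) := by
        gcongr
        exact (H.le_opNorm w).trans (by gcongr; linarith)
      _ = c * ‖w‖ ^ 2 := by field_simp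
  have h_main : c * ‖w‖ ^ 2 ≤ -inner ℝ (H w) (T w) := by
    simpa [ContinuousLinearMap.adjoint_inner_left] using h_coer w
  rw [← sub_add_cancel (W x - W y) (T w), ← hρ, inner_add_right]
  linarith

end HyperbolicEquilibria

section StableSets

variable {E : Type*} [NormedAddCommGroup E] [InnerProductSpace ℝ E] [FiniteDimensional ℝ E]
  {f : E → ℝ} {A : E → E →L[ℝ] E} {e : E}

namespace IsProperGradientSystem

variable (S : IsProperGradientSystem f A)

include S

theorem hasStrictFDerivAt_descentField (he : gradient f e = 0) :
    HasStrictFDerivAt (descentField f A) (-(A e ∘L hessian f e)) e := by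
  have h_apply := (S.contDiff_operator.contDiffAt.hasStrictFDerivAt (x := e) one_ne_zero).clm_apply
    ((contDiff_one_gradient S.contDiff_potential).contDiffAt.hasStrictFDerivAt one_ne_zero)
  convert! h_apply.neg using 2
  simp [he]

theorem exists_ball_inner_hessian_sub_nonpos (he : gradient f e = 0)
    (hinj : Function.Injective (hessian f e)) :
    ∃ r > 0, ∀ x ∈ Metric.ball e r, ∀ y ∈ Metric.ball e r,
      inner ℝ (hessian f e (x - y)) (descentField f A x - descentField f A y) ≤ 0 := by
  refine exists_ball_inner_sub_nonpos (S.hasStrictFDerivAt_descentField he) fun v hv => ?_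
  have h_pos := S.isPosDefOperator e (hessian f e v) ((map_ne_zero_iff _ hinj).2 hv)
  simpa [real_inner_comm] using h_pos

theorem eventually_forall_apply_mem (hmin : ∀ᶠ y in 𝓝[≠] e, f e < f y) {U : Set E} (hU : U ∈ 𝓝 e) :
    ∀ᶠ y in 𝓝 e, ∀ γ, IsForwardSolution (descentField f A) γ → γ 0 = y →
      ∀ t, 0 ≤ t → γ t ∈ U := by
  obtain ⟨ρ, hρ, hball⟩ := Metric.mem_nhdsWithin_iff.1 hmin
  obtain ⟨ρ', hρ', hball'⟩ := Metric.mem_nhds_iff.1 hU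
  obtain ⟨ε, hε, hε_lt⟩ := exists_between (lt_min hρ hρ')
  have h_sphere : ∀ z ∈ Metric.sphere e ε, f e < f z := fun z hz =>
    hball ⟨Metric.mem_ball.2 (hz.trans_lt (hε_lt.trans_le (min_le_left _ _))),
      Metric.ne_of_mem_sphere hz hε.ne'⟩
  have hf := S.contDiff_potential.continuous
  obtain ⟨m, hm, h_barrier⟩ := (isCompact_sphere e ε).exists_forall_le' hf.continuousOn h_sphere
  filter_upwards [Metric.ball_mem_nhds e hε, hf.continuousAt.eventually_lt_const hm]
    with y hy hym γ hγ hγ₀ t ht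
  subst hγ₀
  have h_stay : dist (γ t) e < ε :=
    forall_ge_lt_of_forall_ge_ne
      ((continuous_id.dist continuous_const).comp_continuousOn hγ.continuousOn) hy
      (fun s hs hsε => ((h_barrier _ hsε).trans (S.apply_le_apply_zero hγ hs)).not_gt hym) t ht
  exact hball' (h_stay.trans (hε_lt.trans_le (min_le_right _ _)))

theorem eventually_tendsto (hiso : HasIsolatedCriticalPoints f) (he : gradient f e = 0)
    (hmin : ∀ᶠ y in 𝓝[≠] e, f e < f y) :
    ∀ᶠ y in 𝓝 e, ∀ γ, IsForwardSolution (descentField f A) γ → γ 0 = y →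
      Tendsto γ atTop (𝓝 e) := by
  have h_unique : ∀ᶠ y in 𝓝 e, gradient f y = 0 → y = e := by
    filter_upwards [eventually_nhdsWithin_iff.1 (hiso e he)] with y hy h_crit
    by_contra hne
    exact hy hne h_crit
  obtain ⟨U, hU, hU_closed, hU_unique⟩ := exists_mem_nhds_isClosed_subset h_unique
  filter_upwards [S.eventually_forall_apply_mem hmin hU] with y hy γ hγ hγ₀
  obtain ⟨e', he', hlim⟩ := S.exists_tendsto hiso hγ
  have h_mem : e' ∈ U := hU_closed.mem_of_tendsto hlim
    ((eventually_ge_atTop 0).mono (hy γ hγ hγ₀))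
  rwa [hU_unique h_mem he'] at hlim

theorem isOpen_stableSet (hiso : HasIsolatedCriticalPoints f) (he : gradient f e = 0)
    (hmin : ∀ᶠ y in 𝓝[≠] e, f e < f y) : IsOpen (stableSet (descentField f A) e) := by
  have h_attract := (S.eventually_tendsto hiso he hmin).eventually_nhds
  rw [isOpen_iff_mem_nhds]
  rintro _ ⟨γ, hγ, rfl, hlim⟩
  obtain ⟨T, hT_attract, hT⟩ := ((hlim.eventually h_attract).and (eventually_ge_atTop 0)).exists
  filter_upwards [S.eventually_apply_mem hγ hT hT_attract] with y hy
  obtain ⟨ψ, hψ, rfl⟩ := S.exists_isForwardSolution y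
  have h_shift : Tendsto (fun t => ψ (t + T)) atTop (𝓝 e) :=
    hy ψ hψ rfl _ (hψ.comp_add_const hT) (by rw [zero_add])
  refine ⟨ψ, hψ, rfl, ?_⟩
  simpa [Function.comp_def] using
    h_shift.comp (tendsto_atTop_add_const_right atTop (-T) tendsto_id)

variable [MeasurableSpace E] [BorelSpace E]

theorem volume_setOf_exists_apply_mem_eq_zero {N : Set E} (hN : volume N = 0) {T : ℝ}
    (hT : 0 ≤ T) :
    volume {x | ∃ γ, IsForwardSolution (descentField f A) γ ∧ γ 0 = x ∧ γ T ∈ N} = 0 := by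
  choose φ hφ hφ₀ using S.exists_isForwardSolution
  have h_cover : {x | ∃ γ, IsForwardSolution (descentField f A) γ ∧ γ 0 = x ∧ γ T ∈ N} ⊆
      ⋃ n : ℕ, {x | f x ≤ n ∧ φ x T ∈ N} := by
    rintro _ ⟨γ, hγ, rfl, hγN⟩
    obtain ⟨n, hn⟩ := exists_nat_ge (f (γ 0))
    rw [S.eqOn_of_apply_zero_eq hγ (hφ _) (hφ₀ _).symm hT] at hγN
    exact mem_iUnion.2 ⟨n, hn, hγN⟩
  refine measure_mono_null h_cover (measure_iUnion_null fun n => ?_)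
  obtain ⟨K, hK⟩ := S.exists_dist_le_mul_exp n
  refine volume_eq_zero_of_dist_le_mul_dist (Φ := fun x => φ x T)
    (C := ⟨Real.exp (K * T), (Real.exp_pos _).le⟩) (fun x hx y hy => ?_)
    (measure_mono_null (image_subset_iff.2 fun x hx => hx.2) hN)
  have h_dist := (hK _ _ (hφ x) (hφ y) (by rw [hφ₀]; exact hx.1) (by rw [hφ₀]; exact hy.1) T hT).2
  rw [hφ₀, hφ₀, mul_comm] at h_dist
  exact h_dist

theorem volume_stableSet_eq_zero (he : gradient f e = 0) (hinj : Function.Injective (hessian f e))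
    {u : E} (hu : inner ℝ (hessian f e u) u < 0) : volume (stableSet (descentField f A) e) = 0 := by
  obtain ⟨r, hr, hball⟩ := S.exists_ball_inner_hessian_sub_nonpos he hinj
  have h_local : volume (localStableSet (descentField f A) (Metric.ball e r) e) = 0 :=
    volume_eq_zero_of_inner_sub_nonneg (fun x hx y hy => inner_sub_nonneg_of_mem_localStableSet
      (isSymmetric_hessian S.contDiff_potential e) hball hx hy) hu
  exact measure_mono_null (stableSet_subset_iUnion (Metric.ball_mem_nhds e hr))
    (measure_iUnion_null fun n => S.volume_setOf_exists_apply_mem_eq_zero h_local n.cast_nonneg)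

end IsProperGradientSystem

end StableSets

section BasinDecomposition

variable {E : Type*} [NormedAddCommGroup E] [InnerProductSpace ℝ E] [FiniteDimensional ℝ E]
  {f : E → ℝ} {A : E → E →L[ℝ] E}

namespace IsProperGradientSystem

variable (S : IsProperGradientSystem f A)

include S

theorem le_of_mem_stableSet {e x : E} (hx : x ∈ stableSet (descentField f A) e) : f e ≤ f x := by
  obtain ⟨γ, hγ, rfl, hlim⟩ := hx
  exact S.le_apply_of_mapClusterPt hγ hlim.mapClusterPt le_rfl

theorem disjoint_stableSet {e e' : E} (hne : e ≠ e') :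
    Disjoint (stableSet (descentField f A) e) (stableSet (descentField f A) e') := by
  rw [Set.disjoint_left]
  rintro _ ⟨γ, hγ, rfl, hlim⟩ ⟨γ', hγ', h₀, hlim'⟩
  have h_eq : γ' =ᶠ[atTop] γ :=
    (eventually_ge_atTop 0).mono fun t ht => S.eqOn_of_apply_zero_eq hγ' hγ h₀ ht
  exact hne (tendsto_nhds_unique hlim (hlim'.congr' h_eq))

theorem locallyFinite_stableSet (hiso : HasIsolatedCriticalPoints f) :
    LocallyFinite fun e : {e | gradient f e = 0} => stableSet (descentField f A) (e : E) := by
  intro x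
  refine ⟨{y | f y < f x + 1},
    S.contDiff_potential.continuous.continuousAt.eventually_lt_const (lt_add_one _), ?_⟩
  refine ((hiso.finite_inter (contDiff_one_gradient S.contDiff_potential).continuous
    (S.isCompact_sublevel (f x + 1))).preimage Subtype.val_injective.injOn).subset ?_
  rintro ⟨e, he⟩ ⟨y, hy, hy_lt⟩
  exact ⟨he, (S.le_of_mem_stableSet hy).trans (le_of_lt hy_lt)⟩

theorem isOpen_stableSet_of_isNondegenerateMin (hM : HasNondegenerateCriticalPoints f) {e : E}
    (he : IsNondegenerateMin f e) : IsOpen (stableSet (descentField f A) e) :=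
  S.isOpen_stableSet (hM.hasIsolatedCriticalPoints S.contDiff_potential) he.1
    (he.eventually_lt S.contDiff_potential)

variable [MeasurableSpace E] [BorelSpace E]

theorem ae_exists_mem_stableSet (hM : HasNondegenerateCriticalPoints f) :
    ∀ᵐ x, ∃ e, IsNondegenerateMin f e ∧ x ∈ stableSet (descentField f A) e := by
  have hf := S.contDiff_potential
  have hiso := hM.hasIsolatedCriticalPoints hf
  have h_saddle : ∀ e ∈ {e | gradient f e = 0}, ∀ᵐ x,
      x ∈ stableSet (descentField f A) e → IsNondegenerateMin f e := by
    intro e he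
    by_cases hmin : IsNondegenerateMin f e
    · exact .of_forall fun x _ => hmin
    obtain ⟨u, hu⟩ := exists_inner_hessian_neg hf hM he hmin
    filter_upwards [measure_eq_zero_iff_ae_notMem.1
      (S.volume_stableSet_eq_zero he (hM e he) hu)] with x hx hx_mem using absurd hx_mem hx
  filter_upwards [(ae_ball_iff (hiso.countable (contDiff_one_gradient hf).continuous)).2 h_saddle]
    with x hx
  obtain ⟨γ, hγ, h₀⟩ := S.exists_isForwardSolution x
  obtain ⟨e, he, hlim⟩ := S.exists_tendsto hiso hγ
  have hx_mem : x ∈ stableSet (descentField f A) e := ⟨γ, hγ, h₀, hlim⟩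
  exact ⟨e, hx e he hx_mem, hx_mem⟩

theorem iUnion_closure_stableSet (hM : HasNondegenerateCriticalPoints f) :
    ⋃ e ∈ {e | IsNondegenerateMin f e}, closure (stableSet (descentField f A) e) = univ := by
  have h_subset : {e | IsNondegenerateMin f e} ⊆ {e | gradient f e = 0} := fun e he => he.1
  have h_finite := (S.locallyFinite_stableSet
    (hM.hasIsolatedCriticalPoints S.contDiff_potential)).comp_injective
      (inclusion_injective h_subset)
  have h_dense : Dense
      (⋃ e : {e | IsNondegenerateMin f e}, stableSet (descentField f A) (e : E)) := by
    refine (Measure.dense_of_ae (S.ae_exists_mem_stableSet hM)).mono ?_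
    rintro x ⟨e, he, hx⟩
    exact mem_iUnion.2 ⟨⟨e, he⟩, hx⟩
  rw [biUnion_eq_iUnion, ← h_dense.closure_eq]
  exact h_finite.closure_iUnion.symm

theorem volume_closure_inter_closure_stableSet (hM : HasNondegenerateCriticalPoints f) {e e' : E}
    (hne : e ≠ e') : volume (closure (stableSet (descentField f A) e) ∩
      closure (stableSet (descentField f A) e')) = 0 := by
  refine measure_eq_zero_iff_ae_notMem.2 ?_
  filter_upwards [S.ae_exists_mem_stableSet hM] with x ⟨m, hm, hxm⟩ hx
  have h_eq : ∀ a, x ∈ closure (stableSet (descentField f A) a) → m = a := by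
    intro a ha
    by_contra hma
    exact Set.disjoint_left.1 ((S.disjoint_stableSet hma).closure_right
      (S.isOpen_stableSet_of_isNondegenerateMin hM hm)) hxm ha
  exact hne ((h_eq e hx.1).symm.trans (h_eq e' hx.2))

end IsProperGradientSystem

theorem theorem3_general [MeasurableSpace E] [BorelSpace E] (S : IsProperGradientSystem f A)
    (hM : HasNondegenerateCriticalPoints f) :
    (∀ x, ∃ γ, IsForwardSolution (descentField f A) γ ∧ γ 0 = x) ∧
    (∀ γ γ', IsForwardSolution (descentField f A) γ → IsForwardSolution (descentField f A) γ' →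
      γ 0 = γ' 0 → EqOn γ γ' (Ici 0)) ∧
    (∀ γ, IsForwardSolution (descentField f A) γ →
      Bornology.IsBounded (γ '' Ici 0) ∧ ∃ e, gradient f e = 0 ∧ Tendsto γ atTop (𝓝 e)) ∧
    (∀ B, Bornology.IsBounded B → ({e | IsNondegenerateMin f e} ∩ B).Finite) ∧
    (⋃ e ∈ {e | IsNondegenerateMin f e}, closure (stableSet (descentField f A) e)) = univ ∧
    ∀ e e', e ≠ e' → volume (closure (stableSet (descentField f A) e) ∩
      closure (stableSet (descentField f A) e')) = 0 := by
  have hiso := hM.hasIsolatedCriticalPoints S.contDiff_potential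
  refine ⟨S.exists_isForwardSolution, fun γ γ' hγ hγ' => S.eqOn_of_apply_zero_eq hγ hγ',
    fun γ hγ => ⟨S.isBounded_image hγ, S.exists_tendsto hiso hγ⟩, fun B hB => ?_,
    S.iUnion_closure_stableSet hM, fun e e' => S.volume_closure_inter_closure_stableSet hM⟩
  exact (hiso.finite_inter (contDiff_one_gradient S.contDiff_potential).continuous
    hB.isCompact_closure).subset (inter_subset_inter (fun e he => he.1) subset_closure)

end BasinDecomposition

section MatrixOperators

variable {D : ℕ}

theorem isPosDefOperator_toEuclideanCLM {A : Matrix (Fin D) (Fin D) ℝ} (hA : A.PosDef) :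
    IsPosDefOperator (Matrix.toEuclideanCLM (𝕜 := ℝ) A) := by
  intro v hv
  rw [real_inner_comm, Matrix.inner_toEuclideanCLM]
  simpa using hA.dotProduct_mulVec_pos (x := v.ofLp) (by simpa using hv)

variable {F : Type*} [NormedAddCommGroup F] [NormedSpace ℝ F] {n : WithTop ℕ∞}
  {R : F → Matrix (Fin D) (Fin D) ℝ}

theorem contDiff_toEuclideanCLM (hR : ∀ i j, ContDiff ℝ n fun x => R x i j) :
    ContDiff ℝ n fun x => Matrix.toEuclideanCLM (𝕜 := ℝ) (R x) := by
  refine contDiff_clm_apply_iff.2 fun v => contDiff_euclidean.2 fun i => ?_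
  simp only [Matrix.ofLp_toEuclideanCLM, Matrix.mulVec, dotProduct]
  exact ContDiff.sum fun j _ => (hR i j).mul contDiff_const

theorem toEuclideanCLM_inv {A : Matrix (Fin D) (Fin D) ℝ} (hA : IsUnit A) :
    Matrix.toEuclideanCLM (𝕜 := ℝ) A⁻¹ = Ring.inverse (Matrix.toEuclideanCLM (𝕜 := ℝ) A) := by
  obtain ⟨u, rfl⟩ := hA
  rw [← Matrix.coe_units_inv]
  let Φ : Matrix (Fin D) (Fin D) ℝ →* (EuclideanSpace ℝ (Fin D) →L[ℝ] EuclideanSpace ℝ (Fin D)) :=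
    Matrix.toEuclideanCLM (n := Fin D) (𝕜 := ℝ)
  exact (Ring.inverse_unit (Units.map Φ u)).symm

theorem contDiff_toEuclideanCLM_inv (hR : ∀ i j, ContDiff ℝ n fun x => R x i j)
    (hunit : ∀ x, IsUnit (R x)) :
    ContDiff ℝ n fun x => Matrix.toEuclideanCLM (𝕜 := ℝ) (R x)⁻¹ := by
  simp only [toEuclideanCLM_inv (hunit _)]
  refine contDiff_iff_contDiffAt.2 fun x => ?_
  obtain ⟨u, hu⟩ := (hunit x).map (Matrix.toEuclideanCLM (n := Fin D) (𝕜 := ℝ))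
  exact ContDiffAt.comp (g := Ring.inverse) x (hu ▸ contDiffAt_ringInverse ℝ u)
    (contDiff_toEuclideanCLM hR).contDiffAt

end MatrixOperators

section GaussianProfiles

variable {E : Type*} [NormedAddCommGroup E] [InnerProductSpace ℝ E] {T : E →L[ℝ] E}

/-- The unnormalized Gaussian `exp (-⟪x - μ, T (x - μ)⟫ / 2)` with mean `μ` and precision
operator `T`, the inverse of the covariance. -/
noncomputable def gaussianProfile (T : E →L[ℝ] E) (μ x : E) : ℝ :=
  Real.exp (-(1 / 2) * inner ℝ (x - μ) (T (x - μ)))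

theorem contDiff_gaussianProfile (T : E →L[ℝ] E) (μ : E) {n : WithTop ℕ∞} :
    ContDiff ℝ n (gaussianProfile T μ) := by
  have h_sub : ContDiff ℝ n fun x : E => x - μ := contDiff_id.sub contDiff_const
  exact (contDiff_const.mul (h_sub.inner ℝ (T.contDiff.comp h_sub))).exp

theorem fderiv_gaussianProfile (T : E →L[ℝ] E) (μ x v : E) :
    fderiv ℝ (gaussianProfile T μ) x v = gaussianProfile T μ x *
      (-(1 / 2) * (inner ℝ (x - μ) (T v) + inner ℝ v (T (x - μ)))) := by
  have h_sub : HasFDerivAt (fun x : E => x - μ) (ContinuousLinearMap.id ℝ E) x :=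
    (hasFDerivAt_id x).sub_const μ
  have h_quad := h_sub.inner ℝ (T.hasFDerivAt.comp x h_sub)
  have h_exp : HasFDerivAt (gaussianProfile T μ) _ x := (h_quad.const_mul (-(1 / 2) : ℝ)).exp
  rw [h_exp.fderiv]
  simp [fderivInnerCLM_apply, gaussianProfile]

variable [FiniteDimensional ℝ E]

theorem tendsto_gaussianProfile_cocompact (hT : IsPosDefOperator T) (μ : E) :
    Tendsto (gaussianProfile T μ) (cocompact E) (𝓝 0) := by
  obtain ⟨c, hc, hcoer⟩ := hT.exists_mul_sq_norm_le_inner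
  have h_dist : Tendsto (fun x => c * dist x μ ^ 2) (cocompact E) atTop :=
    ((tendsto_pow_atTop two_ne_zero).comp (tendsto_dist_right_cocompact_atTop μ)).const_mul_atTop hc
  have h_quad : Tendsto (fun x => inner ℝ (x - μ) (T (x - μ))) (cocompact E) atTop := by
    refine tendsto_atTop_mono (fun x => ?_) h_dist
    rw [dist_eq_norm, real_inner_comm]
    exact hcoer _
  exact Real.tendsto_exp_atBot.comp (h_quad.const_mul_atTop_of_neg (by norm_num))

theorem eventually_fderiv_gaussianProfile_self_neg (hT : IsPosDefOperator T) (μ : E) :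
    ∀ᶠ x in cocompact E, fderiv ℝ (gaussianProfile T μ) x x < 0 := by
  obtain ⟨c, hc, hcoer⟩ := hT.exists_mul_sq_norm_le_inner
  filter_upwards [tendsto_norm_cocompact_atTop.eventually_gt_atTop (‖T‖ * ‖μ‖ / c)] with x hx
  have hx_pos : 0 < ‖x‖ := lt_of_le_of_lt (by positivity) hx
  have h_left : inner ℝ μ (T x) ≤ ‖T‖ * ‖μ‖ * ‖x‖ :=
    calc inner ℝ μ (T x) ≤ ‖μ‖ * ‖T x‖ := real_inner_le_norm _ _
      _ ≤ ‖μ‖ * (‖T‖ * ‖x‖) := by gcongr; exact T.le_opNorm x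
      _ = ‖T‖ * ‖μ‖ * ‖x‖ := by ring
  have h_right : inner ℝ x (T μ) ≤ ‖T‖ * ‖μ‖ * ‖x‖ :=
    calc inner ℝ x (T μ) ≤ ‖x‖ * ‖T μ‖ := real_inner_le_norm _ _
      _ ≤ ‖x‖ * (‖T‖ * ‖μ‖) := by gcongr; exact T.le_opNorm μ
      _ = ‖T‖ * ‖μ‖ * ‖x‖ := by ring
  have h_far : ‖T‖ * ‖μ‖ * ‖x‖ < c * ‖x‖ ^ 2 :=
    calc ‖T‖ * ‖μ‖ * ‖x‖ < ‖x‖ * c * ‖x‖ :=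
          mul_lt_mul_of_pos_right ((div_lt_iff₀ hc).1 hx) hx_pos
      _ = c * ‖x‖ ^ 2 := by ring
  rw [fderiv_gaussianProfile]
  refine mul_neg_of_pos_of_neg (Real.exp_pos _) ?_
  rw [map_sub, inner_sub_left, inner_sub_right, real_inner_comm (T x) x]
  linarith [hcoer x]

end GaussianProfiles

namespace GaussianMixture

variable {D K : ℕ} (M : GaussianMixture D K)

/-- The precision operator `Σₖ⁻¹` of the `k`-th component. -/
noncomputable def precision (k : Fin K) : EuclideanSpace ℝ (Fin D) →L[ℝ] EuclideanSpace ℝ (Fin D) :=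
  Matrix.toEuclideanCLM (𝕜 := ℝ) (M.cov k)⁻¹

/-- The peak height `πₖ (2π)^(-D/2) |Σₖ|^(-1/2)` of the `k`-th weighted component. -/
noncomputable def amplitude (k : Fin K) : ℝ :=
  M.weight k * ((2 * Real.pi) ^ (-(D : ℝ) / 2) * (M.cov k).det ^ (-(1 : ℝ) / 2))

theorem isPosDefOperator_precision (k : Fin K) : IsPosDefOperator (M.precision k) :=
  isPosDefOperator_toEuclideanCLM (M.cov_posDef k).inv

theorem amplitude_pos (k : Fin K) : 0 < M.amplitude k := by
  have h_weight := M.weight_pos k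
  have h_det := (M.cov_posDef k).det_pos
  rw [amplitude]
  positivity

theorem density_eq_sum_gaussianProfile :
    M.density = fun x => ∑ k, M.amplitude k * gaussianProfile (M.precision k) (M.mean k) x := by
  funext x
  simp only [density, gaussianDensity, amplitude, gaussianProfile, precision, mul_assoc]

include M in
theorem nonempty_components : Nonempty (Fin K) := by
  by_contra h
  rw [not_nonempty_iff] at h
  simpa using M.weight_sum

theorem density_pos (x : EuclideanSpace ℝ (Fin D)) : 0 < M.density x := by
  have := M.nonempty_components
  rw [density_eq_sum_gaussianProfile]
  exact Finset.sum_pos (fun k _ => mul_pos (M.amplitude_pos k) (Real.exp_pos _))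
    Finset.univ_nonempty

theorem contDiff_density {n : WithTop ℕ∞} : ContDiff ℝ n M.density := by
  rw [density_eq_sum_gaussianProfile]
  exact ContDiff.sum fun k _ => contDiff_const.mul (contDiff_gaussianProfile _ _)

theorem contDiff_potential {n : WithTop ℕ∞} : ContDiff ℝ n M.potential :=
  (M.contDiff_density.log fun x => (M.density_pos x).ne').neg

theorem tendsto_density_cocompact : Tendsto M.density (cocompact _) (𝓝 0) := by
  rw [density_eq_sum_gaussianProfile]
  simpa using tendsto_finsetSum Finset.univ fun k _ =>
    (tendsto_gaussianProfile_cocompact (M.isPosDefOperator_precision k) (M.mean k)).const_mul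
      (M.amplitude k)

theorem tendsto_potential_cocompact : Tendsto M.potential (cocompact _) atTop :=
  tendsto_neg_atBot_atTop.comp (Real.tendsto_log_nhdsGT_zero.comp
    (tendsto_nhdsWithin_iff.2 ⟨M.tendsto_density_cocompact, .of_forall M.density_pos⟩))

theorem isCompact_sublevel_potential (c : ℝ) : IsCompact {x | M.potential x ≤ c} := by
  obtain ⟨s, hs, hsub⟩ := mem_cocompact.1 (M.tendsto_potential_cocompact.eventually_gt_atTop c)
  refine hs.of_isClosed_subset
    (isClosed_le (M.contDiff_potential (n := 0)).continuous continuous_const) fun x hx => ?_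
  by_contra hxs
  have h_gt : c < M.potential x := hsub hxs
  exact h_gt.not_ge hx

theorem fderiv_density (x v : EuclideanSpace ℝ (Fin D)) : fderiv ℝ M.density x v =
    ∑ k, M.amplitude k * fderiv ℝ (gaussianProfile (M.precision k) (M.mean k)) x v := by
  have h_diff : ∀ k, DifferentiableAt ℝ (gaussianProfile (M.precision k) (M.mean k)) x := fun k =>
    (contDiff_gaussianProfile _ _ (n := 1)).differentiable one_ne_zero x
  rw [density_eq_sum_gaussianProfile,
    (HasFDerivAt.fun_sum fun k _ => (h_diff k).hasFDerivAt.const_mul (M.amplitude k)).fderiv]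
  simp

theorem eventually_fderiv_density_self_neg : ∀ᶠ x in cocompact _, fderiv ℝ M.density x x < 0 := by
  have := M.nonempty_components
  filter_upwards [eventually_all.2 fun k => eventually_fderiv_gaussianProfile_self_neg
    (M.isPosDefOperator_precision k) (M.mean k)] with x hx
  rw [fderiv_density]
  exact Finset.sum_neg (fun k _ => mul_neg_of_pos_of_neg (M.amplitude_pos k) (hx k))
    Finset.univ_nonempty

theorem fderiv_potential (x : EuclideanSpace ℝ (Fin D)) :
    fderiv ℝ M.potential x = -((M.density x)⁻¹ • fderiv ℝ M.density x) := by
  have h_diff : DifferentiableAt ℝ M.density x :=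
    (M.contDiff_density (n := 1)).differentiable one_ne_zero x
  exact (h_diff.hasFDerivAt.log (M.density_pos x).ne').neg.fderiv

theorem isBounded_isEquilibrium : Bornology.IsBounded {e | IsEquilibrium M.potential e} := by
  rw [Bornology.isBounded_def, Metric.cobounded_eq_cocompact]
  filter_upwards [M.eventually_fderiv_density_self_neg] with x hx h_crit
  have h_zero : fderiv ℝ M.potential x x = 0 := by
    rw [← inner_gradient_left, h_crit, inner_zero_left]
  rw [fderiv_potential] at h_zero
  simp [(M.density_pos x).ne', hx.ne] at h_zero

theorem isProperGradientSystem {R : EuclideanSpace ℝ (Fin D) → Matrix (Fin D) (Fin D) ℝ}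
    (hRpos : ∀ x, (R x).PosDef) (hRdiff : ∀ i j, ContDiff ℝ 1 fun x => R x i j) :
    IsProperGradientSystem M.potential fun x => Matrix.toEuclideanCLM (𝕜 := ℝ) (R x)⁻¹ where
  contDiff_potential := M.contDiff_potential
  contDiff_operator := contDiff_toEuclideanCLM_inv hRdiff fun x => (hRpos x).isUnit
  isPosDefOperator x := isPosDefOperator_toEuclideanCLM (hRpos x).inv
  isCompact_sublevel := M.isCompact_sublevel_potential

end GaussianMixture

section StableEquilibria

variable {D : ℕ} {f : EuclideanSpace ℝ (Fin D) → ℝ} {e : EuclideanSpace ℝ (Fin D)}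

theorem injective_hessian_iff_not_hasEigenvalue_zero :
    Function.Injective (hessian f e) ↔ ¬ (hessianOp f e).HasEigenvalue 0 := by
  rw [Module.End.hasEigenvalue_iff, Module.End.eigenspace_zero, not_not]
  exact LinearMap.ker_eq_bot.symm

theorem IsMorse.hasNondegenerateCriticalPoints (hM : IsMorse f) :
    HasNondegenerateCriticalPoints f := fun e he =>
  injective_hessian_iff_not_hasEigenvalue_zero.2 (hM e he).2

theorem isStableEquilibrium_iff_isNondegenerateMin (hf : ContDiff ℝ 2 f) :
    IsStableEquilibrium f e ↔ IsNondegenerateMin f e := by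
  constructor
  · rintro ⟨⟨he, -⟩, h_pos⟩
    exact ⟨he, isPosDefOperator_of_hasEigenvalue_pos (isSymmetric_hessian hf e) h_pos⟩
  · rintro ⟨he, h_pos⟩
    refine ⟨⟨he, injective_hessian_iff_not_hasEigenvalue_zero.1 h_pos.injective⟩, fun c hc => ?_⟩
    obtain ⟨v, hv⟩ := hc.exists_hasEigenvector
    have h_apply : hessian f e v = c • v := hv.apply_eq_smul
    have h_inner := h_pos v hv.2
    rw [h_apply, real_inner_smul_left] at h_inner
    exact pos_of_mul_pos_left h_inner real_inner_self_nonneg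

end StableEquilibria

theorem theorem3 {D K : ℕ} (M : GaussianMixture D K) (hM : IsMorse M.potential)
    (R : EuclideanSpace ℝ (Fin D) → Matrix (Fin D) (Fin D) ℝ)
    (hRpos : ∀ x, (R x).PosDef)
    (hRdiff : ∀ i j, ContDiff ℝ 1 (fun x => R x i j))
    (hRcond : ∃ C : ℝ, ∀ x, conditionNumber (R x) ≤ C) :
    -- from every initial point there is exactly one trajectory
    (∀ x, ∃ γ, IsTrajectory M.potential R γ ∧ γ 0 = x) ∧
    (∀ γ γ', IsTrajectory M.potential R γ → IsTrajectory M.potential R γ' → γ 0 = γ' 0 →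
      EqOn γ γ' (Ici 0)) ∧
    -- every trajectory is bounded and converges to an equilibrium vector
    (∀ γ, IsTrajectory M.potential R γ →
      Bornology.IsBounded (γ '' Ici 0) ∧
        ∃ e, IsEquilibrium M.potential e ∧ Tendsto γ atTop (𝓝 e)) ∧
    -- the stable equilibrium vectors are finitely many, their basin cells cover the space
    {e | IsStableEquilibrium M.potential e}.Finite ∧
    (⋃ e ∈ {e | IsStableEquilibrium M.potential e}, basinCell M.potential R e) = univ ∧
    -- and any two of these basin cells meet in a Lebesgue null set
    (∀ e e', IsStableEquilibrium M.potential e → IsStableEquilibrium M.potential e' → e ≠ e' →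
      volume (basinCell M.potential R e ∩ basinCell M.potential R e') = 0) := by
  obtain ⟨h_exists, h_unique, h_tendsto, h_finite, h_cover, h_null⟩ :=
    theorem3_general (M.isProperGradientSystem hRpos hRdiff) hM.hasNondegenerateCriticalPoints
  simp only [isStableEquilibrium_iff_isNondegenerateMin M.contDiff_potential]
  refine ⟨h_exists, h_unique, h_tendsto, ?_, h_cover, fun e e' _ _ => h_null e e'⟩
  exact (h_finite _ M.isBounded_isEquilibrium).subset fun e he => ⟨he, he.1⟩
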